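/- For a prime power $q$, let $\mathbb{F}_q$ be a finite field of order $q$, and for a divisor $d \mid q-1$ let $G_{q,d}=\{x\in\mathbb{F}_q^\times : x^d=1\}$ be the unique subgroup of order $d$ of $\mathbb{F}_q^\times$. If $q$ is a power of $3$, a subset $S\subseteq\mathbb{F}_q$ is called a cap set if $a+b+c\neq 0$ for all distinct $a,b,c\in S$; if $q$ is a power of $2$, a subset $S\subseteq\mathbb{F}_q$ is called a cap set if $a+b+c+d\ne 0$ for all distinct $a,b,c,d\in S$. A cap set in $\mathbb{F}_q$ is maximal if no cap set in $\mathbb{F}_q$ has more elements, and complete if it is not properly contained in any cap set in $\mathbb{F}_q$. 1. The cosets of $G_{81,20}$ form a partition of $\mathbb{F}_{81}^\times$ into $4$ maximal cap sets, each of size $20$. 2. The cosets of $G_{243,22}$ form a partition of $\mathbb{F}_{243}^\times$ into $11$ complete cap sets of size $22$. 3. The cosets of $G_{729,28}$ form a partition of $\mathbb{F}_{729}^\times$ into $26$ cap sets of size $28$. Moreover, these cosets may be paired so that the unions of the pairs form a partition of $\mathbb{F}_{729}^\times$ into $13$ cap sets of size $56$. 4. For every integer $n\ge 1$, the cosets of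 $G_{2^{2n},2^n+1}$ form a partition of $\mathbb{F}_{2^{2n}}^\times$ into $2^n-1$ cap sets of size $2^n+1$. -/

import Mathlib

open scoped Pointwise

/-- A cap set in a field of order `3 ^ m`: no three distinct elements sum to zero. -/
def IsCapThree {F : Type*} [Field F] (S : Set F) : Prop :=
  ∀ a ∈ S, ∀ b ∈ S, ∀ c ∈ S, a ≠ b → a ≠ c → b ≠ c → a + b + c ≠ 0

/-- A cap set in a field of order `2 ^ m`: no four distinct elements sum to zero. -/
def IsCapTwo {F : Type*} [Field F] (S : Set F) : Prop :=
  ∀ a ∈ S, ∀ b ∈ S, ∀ c ∈ S, ∀ d ∈ S,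
    a ≠ b → a ≠ c → a ≠ d → b ≠ c → b ≠ d → c ≠ d → a + b + c + d ≠ 0

/-- A maximal cap set: a cap set of the largest possible size in `F` (used for finite `F`). -/
def IsMaximalCapThree {F : Type*} [Field F] (S : Set F) : Prop :=
  IsCapThree S ∧ ∀ T : Set F, IsCapThree T → T.ncard ≤ S.ncard

/-- A complete cap set: a cap set not contained in any larger cap set. -/
def IsCompleteCapThree {F : Type*} [Field F] (S : Set F) : Prop :=
  IsCapThree S ∧ ∀ T : Set F, IsCapThree T → S ⊆ T → T = S

/-- The cosets `x G` of a subgroup `G` of the multiplicative group, as subsets of the field. -/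
def multCosets {F : Type*} [Field F] (G : Subgroup Fˣ) : Set (Set F) :=
  {C | ∃ x : Fˣ, C = (fun u : Fˣ => (u : F)) '' (x • (G : Set Fˣ))}

/-- `P` is a partition of the set `A`: its members are nonempty, pairwise disjoint,
and their union is `A`. -/
def IsPartitionOf {α : Type*} (P : Set (Set α)) (A : Set α) : Prop :=
  (∀ C ∈ P, C.Nonempty) ∧ P.PairwiseDisjoint id ∧ ⋃₀ P = A

/-! The cosets of the `d`-th roots of unity are the fibres of `z ↦ z ^ d` over nonzero values, so
the partition and counting claims are formal. The cap property comes from Frobenius: each exponent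
lies close to a power of the characteristic (`2 ^ n + 1`, `20 = 2 * (9 + 1)`, `22 = 27 - 5`, `28 =
27 + 1`), so a vanishing sum of elements of one fibre becomes a low-degree equation. In
characteristic three, scaling reduces the cap property to `u ^ d = (1 + u) ^ d = 1 → u = 1`.

Maximality in order 81 is the bound of 20 for caps in dimension four
(`SumThreeFree.card_le_twenty`). It comes from second and third moments of hyperplane sections, by
induction on the dimension through the bounds 2, 4, 9, 20.

Completeness in order 243 says that `(1 + u) ^ 22` takes every value in the group of 11th roots of
unity other than 1 as `u` runs over the 22nd roots of unity other than `±1`. This follows because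
the map is at most two-to-one from 20 elements to 10.

In order 729 the 28th powers of nonzero elements are the nonzero elements of the subfield of order
27. Fibres over `α` and `α * y` are paired, where `y` is a nonsquare there with `y ^ 3 = y - 1`;
`ne_of_pow_three` rules out mixed zero-sum triples. -/

/-! ### Cosets of roots of unity as fibres of a power map. -/

theorem mem_multCosets_rootsOfUnity {F : Type*} [Field F] {d : ℕ} (hd : 0 < d) {C : Set F} :
    C ∈ multCosets (rootsOfUnity d F) ↔ ∃ x : F, x ≠ 0 ∧ C = {z | z ^ d = x ^ d} := by
  have key : ∀ x : Fˣ, (fun u : Fˣ => (u : F)) '' (x • (rootsOfUnity d F : Set Fˣ)) =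
      {z : F | z ^ d = (x : F) ^ d} := by
    intro x
    ext z
    simp only [Set.mem_image, Set.mem_smul_set, SetLike.mem_coe, mem_rootsOfUnity, smul_eq_mul,
      Set.mem_ofPred_eq]
    constructor
    · rintro ⟨_, ⟨u, hu, rfl⟩, rfl⟩
      have hu' : (u : F) ^ d = 1 := by
        rw [← Units.val_pow_eq_pow_val, hu, Units.val_one]
      rw [Units.val_mul, mul_pow, hu', mul_one]
    · intro h
      have hz : z ≠ 0 := by
        rintro rfl
        rw [zero_pow hd.ne'] at h
        exact pow_ne_zero d x.ne_zero h.symm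
      refine ⟨Units.mk0 z hz, ⟨x⁻¹ * Units.mk0 z hz, ?_, by group⟩, rfl⟩
      ext
      simp [mul_pow, h]
  constructor
  · rintro ⟨x, rfl⟩
    exact ⟨x, x.ne_zero, key x⟩
  · rintro ⟨x, hx, rfl⟩
    exact ⟨Units.mk0 x hx, (key (Units.mk0 x hx)).symm⟩

theorem exists_isPrimitiveRoot_of_mul_eq {F : Type*} [Field F] [Finite F] {d k : ℕ}
    (h : Nat.card F = d * k + 1) : ∃ ζ : F, IsPrimitiveRoot ζ d := by
  obtain ⟨g, hg⟩ := IsCyclic.exists_generator (α := Fˣ)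
  have ho : orderOf g = k * d := by
    rw [orderOf_eq_card_of_forall_mem_zpowers hg, Nat.card_units, h, Nat.add_sub_cancel, mul_comm]
  have hg' : IsPrimitiveRoot (g : F) (k * d) := by
    rw [IsPrimitiveRoot.coe_units_iff, ← ho]
    exact IsPrimitiveRoot.orderOf g
  have h2 : 1 < Nat.card F := Finite.one_lt_card
  exact ⟨_, hg'.pow (by rw [mul_comm]; omega) rfl⟩

theorem ncard_setOf_pow_eq_pow {F : Type*} [Field F] [Finite F] {d k : ℕ}
    (h : Nat.card F = d * k + 1) {x : F} (hx : x ≠ 0) : {z : F | z ^ d = x ^ d}.ncard = d := by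
  obtain ⟨ζ, hζ⟩ := exists_isPrimitiveRoot_of_mul_eq h
  have h2 : 1 < Nat.card F := Finite.one_lt_card
  have hd : 0 < d := by
    rcases Nat.eq_zero_or_pos d with rfl | hd
    · omega
    · exact hd
  have : NeZero d := ⟨hd.ne'⟩
  have e : {z : F | z ^ d = x ^ d} = (fun u : rootsOfUnity d F => x * ((u : Fˣ) : F)) '' Set.univ := by
    ext z
    simp only [Set.mem_ofPred_eq, Set.image_univ, Set.mem_range, Subtype.exists, exists_prop]
    constructor
    · intro hz
      have hz0 : z ≠ 0 := by
        rintro rfl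
        rw [zero_pow hd.ne'] at hz
        exact pow_ne_zero d hx hz.symm
      refine ⟨Units.mk0 (z / x) (div_ne_zero hz0 hx), ?_, ?_⟩
      · rw [mem_rootsOfUnity]
        ext
        simp [div_pow, hz, hx]
      · simp only [Units.val_mk0]
        field_simp
    · rintro ⟨u, hu, rfl⟩
      have hu' : (u : F) ^ d = 1 := by
        rw [← Units.val_pow_eq_pow_val, (mem_rootsOfUnity d u).1 hu, Units.val_one]
      rw [mul_pow, hu', mul_one]
  rw [e, Set.ncard_image_of_injective, Set.ncard_univ, hζ.card_rootsOfUnity]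
  intro u v huv
  exact Subtype.ext (Units.ext (mul_left_cancel₀ hx huv))

theorem IsPartitionOf.ncard_mul {α : Type*} [Finite α] {P : Set (Set α)} {A : Set α}
    (h : IsPartitionOf P A) {k : ℕ} (hk : ∀ C ∈ P, C.ncard = k) : P.ncard * k = A.ncard := by
  classical
  obtain ⟨-, hd, hU⟩ := h
  have hP : P.Finite := Set.toFinite P
  rw [← hU, Set.sUnion_eq_biUnion, Set.Finite.ncard_biUnion (s := fun C => C) hP
    (fun _ _ => Set.toFinite _) hd,
    finsum_mem_congr rfl hk, finsum_mem_eq_finite_toFinset_sum _ hP, Finset.sum_const, smul_eq_mul,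
    Set.ncard_eq_toFinset_card P hP]

theorem ncard_setOf_ne_zero {F : Type*} [Field F] [Finite F] :
    {x : F | x ≠ 0}.ncard = Nat.card F - 1 := by
  have : {x : F | x ≠ 0} = {(0 : F)}ᶜ := by ext; simp
  rw [this, Set.ncard_compl, Set.ncard_singleton]

theorem multCosets_rootsOfUnity_partition {F : Type*} [Field F] [Finite F] {d k : ℕ}
    (h : Nat.card F = d * k + 1) :
    IsPartitionOf (multCosets (rootsOfUnity d F)) {x : F | x ≠ 0} ∧
    (multCosets (rootsOfUnity d F)).ncard = k ∧
    ∀ C ∈ multCosets (rootsOfUnity d F), C.ncard = d := by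
  have h2 : 1 < Nat.card F := Finite.one_lt_card
  have hd : 0 < d := by
    rcases Nat.eq_zero_or_pos d with rfl | hd
    · omega
    · exact hd
  have hc : ∀ C ∈ multCosets (rootsOfUnity d F), C.ncard = d := by
    intro C hC
    obtain ⟨x, hx, rfl⟩ := (mem_multCosets_rootsOfUnity hd).1 hC
    exact ncard_setOf_pow_eq_pow h hx
  have hp : IsPartitionOf (multCosets (rootsOfUnity d F)) {x : F | x ≠ 0} := by
    refine ⟨?_, ?_, ?_⟩
    · intro C hC
      obtain ⟨x, hx, rfl⟩ := (mem_multCosets_rootsOfUnity hd).1 hC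
      exact ⟨x, rfl⟩
    · intro C hC D hD hCD
      obtain ⟨x, hx, rfl⟩ := (mem_multCosets_rootsOfUnity hd).1 hC
      obtain ⟨y, hy, rfl⟩ := (mem_multCosets_rootsOfUnity hd).1 hD
      refine Set.disjoint_left.2 fun z hz hz' => hCD ?_
      have e : x ^ d = y ^ d := hz.symm.trans hz'
      rw [e]
    · ext z
      simp only [Set.mem_sUnion, Set.mem_ofPred_eq]
      constructor
      · rintro ⟨C, hC, hz⟩ rfl
        obtain ⟨x, hx, rfl⟩ := (mem_multCosets_rootsOfUnity hd).1 hC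
        exact pow_ne_zero d hx (by rw [← zero_pow hd.ne']; exact Eq.symm hz)
      · intro hz
        exact ⟨_, (mem_multCosets_rootsOfUnity hd).2 ⟨z, hz, rfl⟩, rfl⟩
  refine ⟨hp, ?_, hc⟩
  have := hp.ncard_mul hc
  rw [ncard_setOf_ne_zero, h, Nat.add_sub_cancel, mul_comm] at this
  exact Nat.eq_of_mul_eq_mul_left hd this

/-! ### Characteristic two. -/

theorem charP_of_natCard_eq_prime_pow {F : Type*} [Field F] {p n : ℕ} [Fact p.Prime]
    (h : Nat.card F = p ^ n) : CharP F p := by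
  have : Finite F := Nat.finite_of_card_ne_zero (h ▸ pow_ne_zero n (Fact.out : p.Prime).ne_zero)
  have := Fintype.ofFinite F
  exact charP_of_card_eq_prime_pow (f := n) (by rw [← Nat.card_eq_fintype_card, h])

theorem pow_natCard_sub_one_eq_one {F : Type*} [Field F] [Finite F] {x : F} (hx : x ≠ 0) :
    x ^ (Nat.card F - 1) = 1 := by
  have := Fintype.ofFinite F
  rw [Nat.card_eq_fintype_card, FiniteField.pow_card_sub_one_eq_one x hx]

/-- On the fibre, Frobenius acts as `z ↦ e / z`. Hence a zero sum of four elements forces their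
inverses to sum to zero too, and eliminating `d` from both relations leaves `(a + b) * (a + c) * (b
+ c) = 0`. -/
theorem isCapTwo_setOf_pow_eq {F : Type*} [Field F] [CharP F 2] (n : ℕ) {e : F} (he : e ≠ 0) :
    IsCapTwo {z : F | z ^ (2 ^ n + 1) = e} := by
  intro a ha b hb c hc d hd hab hac had hbc hbd hcd h
  simp only [Set.mem_ofPred_eq] at ha hb hc hd
  have h2 : (2 : F) = 0 := CharTwo.two_eq_zero
  have hF : a ^ 2 ^ n + b ^ 2 ^ n + c ^ 2 ^ n + d ^ 2 ^ n = 0 := by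
    rw [← add_pow_char_pow, ← add_pow_char_pow, ← add_pow_char_pow, h,
      zero_pow (pow_ne_zero n two_ne_zero)]
  rw [pow_succ] at ha hb hc hd
  set A := a ^ 2 ^ n
  set B := b ^ 2 ^ n
  set C := c ^ 2 ^ n
  set D := d ^ 2 ^ n
  have hmul : e * ((a + b) * (a + c) * (b + c)) = 0 := by
    have hd' : d = a + b + c := by linear_combination h - (a + b + c) * h2
    have hD : D = A + B + C := by linear_combination hF - (A + B + C) * h2
    rw [hd', hD] at hd
    have h1 : e * (b * c + a * c + a * b) * (a + b + c) = e * (a * b * c) := by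
      linear_combination (a * b * c) * hd - (b * c * (a + b + c)) * ha
        - (a * c * (a + b + c)) * hb - (a * b * (a + b + c)) * hc
    linear_combination h1
  have hadd : ∀ {x y : F}, x ≠ y → x + y ≠ 0 := fun hxy h0 => hxy (CharTwo.add_eq_zero.1 h0)
  exact mul_ne_zero he (mul_ne_zero (mul_ne_zero (hadd hab) (hadd hac)) (hadd hbc)) hmul

theorem multCosets_partition_isCapTwo {F : Type*} [Field F] {n : ℕ}
    (h : Nat.card F = 2 ^ (2 * n)) :
    IsPartitionOf (multCosets (rootsOfUnity (2 ^ n + 1) F)) {x : F | x ≠ 0} ∧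
    (multCosets (rootsOfUnity (2 ^ n + 1) F)).ncard = 2 ^ n - 1 ∧
    ∀ C ∈ multCosets (rootsOfUnity (2 ^ n + 1) F), IsCapTwo C ∧ C.ncard = 2 ^ n + 1 := by
  have : Finite F := Nat.finite_of_card_ne_zero (h ▸ pow_ne_zero _ two_ne_zero)
  have : CharP F 2 := charP_of_natCard_eq_prime_pow h
  have hq : Nat.card F = (2 ^ n + 1) * (2 ^ n - 1) + 1 := by
    rw [h, mul_comm 2 n, pow_mul]
    obtain ⟨m, hm⟩ : ∃ m, 2 ^ n = m + 1 := Nat.exists_eq_succ_of_ne_zero (by positivity)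
    rw [hm, Nat.add_sub_cancel]
    ring
  obtain ⟨h1, h2, h3⟩ := multCosets_rootsOfUnity_partition hq
  refine ⟨h1, h2, fun C hC => ⟨?_, h3 C hC⟩⟩
  obtain ⟨x, hx, rfl⟩ := (mem_multCosets_rootsOfUnity (by positivity)).1 hC
  exact isCapTwo_setOf_pow_eq n (pow_ne_zero _ hx)

/-! ### Characteristic three: single cosets are caps. -/

section CharThree

variable {F : Type*} [Field F]

/-- Divide `a + b + c = 0` by `a` and set `u = b / a`: then `1 + u = -(c / a)`, and the sign
disappears because `d` is even. -/
theorem isCapThree_setOf_pow_eq {d : ℕ} (hd : Even d)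
    (key : ∀ u : F, u ^ d = 1 → (1 + u) ^ d = 1 → u = 1) {e : F} (he : e ≠ 0) :
    IsCapThree {z : F | z ^ d = e} := by
  intro a ha b hb c hc hab _ _ h
  simp only [Set.mem_ofPred_eq] at ha hb hc
  by_cases hd0 : d = 0
  · have h0 : (1 : F) = 0 := by
      have := key 0 (by rw [hd0, pow_zero]) (by rw [hd0, pow_zero])
      exact this.symm
    exact one_ne_zero h0
  have ha0 : a ≠ 0 := by
    rintro rfl
    rw [zero_pow hd0] at ha
    exact he ha.symm
  have hu : b / a = 1 := by
    apply key
    · rw [div_pow, ha, hb, div_self he]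
    · have : 1 + b / a = -(c / a) := by
        field_simp
        linear_combination h
      rw [this, hd.neg_pow, div_pow, ha, hc, div_self he]
  exact hab ((div_eq_one_iff_eq ha0).1 hu).symm

variable [CharP F 3]

theorem three_eq_zero_of_charP_three : (3 : F) = 0 := by
  simpa using CharP.cast_eq_zero F 3

theorem two_ne_zero_of_charP_three : (2 : F) ≠ 0 := by
  intro h
  have h3 : (3 : F) = 0 := three_eq_zero_of_charP_three
  exact one_ne_zero (α := F) (by linear_combination h3 - h)

/-- Both `u ^ 10` and `(1 + u) ^ 10` are `±1`, while Frobenius gives `(1 + u) ^ 10 = (1 + u) * (1 +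
u ^ 9)`. Each choice of signs yields a quadratic for `u`, to be compared with the sign of `u ^ 10`.
-/
theorem eq_one_of_pow_twenty {u : F} (hu : u ^ 20 = 1) (hv : (1 + u) ^ 20 = 1) : u = 1 := by
  have h3 : (3 : F) = 0 := three_eq_zero_of_charP_three
  have h2 : (2 : F) ≠ 0 := two_ne_zero_of_charP_three
  have h9 : (1 + u) ^ 9 = 1 + u ^ 9 := by
    simpa using add_pow_char_pow (p := 3) (n := 2) (1 : F) u
  have hsq : ∀ w : F, w ^ 20 = 1 → w ^ 10 = 1 ∨ w ^ 10 = -1 := fun w hw =>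
    mul_self_eq_one_iff.1 (by linear_combination hw)
  have hδ : u * (1 + u) ^ 10 = (1 + u) * (u + u ^ 10) := by
    linear_combination u * (1 + u) * h9
  rcases hsq u hu with hε | hε <;> rcases hsq (1 + u) hv with hδ' | hδ' <;> rw [hε, hδ'] at hδ
  · have : (u - 1) ^ 2 = 0 := by linear_combination -hδ - u * h3
    exact sub_eq_zero.1 (pow_eq_zero_iff two_ne_zero |>.1 this)
  · have hq : u ^ 2 = -1 := by linear_combination -hδ - u * h3
    exact absurd (by linear_combination (u ^ 8 - u ^ 6 + u ^ 4 - u ^ 2 + 1) * hq - hε) h2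
  · have hq : u ^ 2 = u + 1 := by linear_combination -hδ
    have hq4 : u ^ 4 = -1 := by linear_combination (u ^ 2 + u + 1) * hq + hq + (u + 1) * h3
    linear_combination hε - (u ^ 6 - u ^ 2) * hq4 - hq - h3
  · have hq : u ^ 2 = 1 - u := by linear_combination -hδ
    have hq4 : u ^ 4 = -1 := by linear_combination (u ^ 2 + 1 - u) * hq + hq + (1 - u) * h3
    have hu1 : u = -1 := by linear_combination -hε + (u ^ 6 - u ^ 2) * hq4 + hq + h3
    rw [hu1] at hε
    exact absurd (by linear_combination hε) h2

/-- As `27 = 22 + 5`, Frobenius reads `(1 + u) ^ 5 = 1 + u ^ 5`; the difference of the sides factors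
using `u ^ 2 + u + 1 = (u - 1) ^ 2` in characteristic three. -/
theorem eq_one_of_pow_twentytwo {u : F} (hu : u ^ 22 = 1) (hv : (1 + u) ^ 22 = 1) : u = 1 := by
  have h3 : (3 : F) = 0 := three_eq_zero_of_charP_three
  have h27 : (1 + u) ^ 27 = 1 + u ^ 27 := by
    simpa using add_pow_char_pow (p := 3) (n := 3) (1 : F) u
  have hu0 : u ≠ 0 := by rintro rfl; simp at hu
  have hu1 : 1 + u ≠ 0 := by intro h; rw [h] at hv; simp at hv
  have h : u * (1 + u) * (u - 1) ^ 2 = 0 := by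
    linear_combination -h27 + (1 + u) ^ 5 * hv - u ^ 5 * hu
      + (2 * u ^ 4 + 3 * u ^ 3 + 3 * u ^ 2 + 2 * u) * h3
  have := (mul_eq_zero.1 h).resolve_left (mul_ne_zero hu0 hu1)
  exact sub_eq_zero.1 (pow_eq_zero_iff two_ne_zero |>.1 this)

/-- Here `u ^ 27` is the inverse of `u`, so `(1 + u) ^ 28 = (1 + u) * (1 + u⁻¹)`. -/
theorem one_add_sq_of_pow_twentyeight {u r : F} (hu : u ^ 28 = 1) (hv : (1 + u) ^ 28 = r) :
    (1 + u) ^ 2 = r * u := by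
  have h27 : (1 + u) ^ 27 = 1 + u ^ 27 := by
    simpa using add_pow_char_pow (p := 3) (n := 3) (1 : F) u
  linear_combination -(1 + u) * hu + u * hv - u * (1 + u) * h27

theorem eq_one_of_pow_twentyeight {u : F} (hu : u ^ 28 = 1) (hv : (1 + u) ^ 28 = 1) : u = 1 := by
  have h3 : (3 : F) = 0 := three_eq_zero_of_charP_three
  have : (u - 1) ^ 2 = 0 := by
    linear_combination one_add_sq_of_pow_twentyeight hu hv - u * h3
  exact sub_eq_zero.1 (pow_eq_zero_iff two_ne_zero |>.1 this)

/-! ### Unions of two cosets of the 28th roots of unity. -/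

section ArtinSchreier

variable {y : F} (hy : y ^ 3 = y - 1)

include hy

theorem pow_twentyseven_of_pow_three : y ^ 27 = y := by
  have h3 : (3 : F) = 0 := three_eq_zero_of_charP_three
  have h9 : y ^ 9 = y ^ 3 - 1 := by
    have := sub_pow_char (p := 3) y (1 : F)
    rw [← hy] at this
    linear_combination this
  have h27 : y ^ 27 = y ^ 9 - 1 := by
    have := sub_pow_char (p := 3) (y ^ 3) (1 : F)
    rw [← h9] at this
    linear_combination this
  linear_combination h27 + h9 + hy - h3

/-- This makes `y` a nonsquare in the field of order 27: `13` is the product of the Frobenius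
exponents `1 + 3 + 9`, so the power is the norm of `y`. -/
theorem pow_thirteen_of_pow_three : y ^ 13 = -1 := by
  have h3 : (3 : F) = 0 := three_eq_zero_of_charP_three
  have h9 : y ^ 9 = y ^ 3 - 1 := by
    have := sub_pow_char (p := 3) y (1 : F)
    rw [← hy] at this
    linear_combination this
  linear_combination y ^ 4 * h9 + (y ^ 4 + y ^ 2 - 2 * y + 1) * hy + (-y ^ 2 + y) * h3

/-- With `u = b / a` and `r = γ / α`, the relation `(1 + u) ^ 2 = r * u` is a quadratic for `u`. For
`r = y` and `r = y⁻¹` its discriminant is a square in the field of order 27, so `u ^ 27 = u`.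
Together with `u ^ 28 = 1` and `u ≠ 1` this leaves only `u = -1`, which fails the quadratic. -/
theorem ne_of_pow_three {γ α a b c : F} (hα : α ≠ 0) (hab : a ≠ b) (h : a + b + c = 0)
    (ha : a ^ 28 = α) (hb : b ^ 28 = α) (hc : c ^ 28 = γ) : γ ≠ α ∧ γ ≠ α * y ∧ γ * y ≠ α := by
  have h3 : (3 : F) = 0 := three_eq_zero_of_charP_three
  have hy0 : y ≠ 0 := by
    rintro rfl
    exact one_ne_zero (α := F) (by linear_combination hy)
  have hy27 := pow_twentyseven_of_pow_three hy
  have hy13 := pow_thirteen_of_pow_three hy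
  have ha0 : a ≠ 0 := by
    rintro rfl
    rw [zero_pow (by norm_num)] at ha
    exact hα ha.symm
  obtain ⟨u, rfl⟩ : ∃ u, b = a * u := ⟨b / a, by field_simp⟩
  have hu : u ^ 28 = 1 := by
    rw [mul_pow, ha] at hb
    exact mul_left_cancel₀ hα (by rw [hb, mul_one])
  have hu1 : u ≠ 1 := by
    rintro rfl
    exact hab (mul_one a).symm
  have hv : α * (1 + u) ^ 28 = γ := by
    rw [← ha, ← mul_pow, ← hc, ← Even.neg_pow (by decide) c]
    congr 1
    linear_combination h
  have hneg : u ^ 27 = u → u = -1 := by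
    intro h27
    have : u * u = 1 := by linear_combination hu - u * h27
    exact (mul_self_eq_one_iff.1 this).resolve_left hu1
  refine ⟨?_, ?_, ?_⟩ <;> intro hγ
  · exact hu1 (eq_one_of_pow_twentyeight hu (mul_left_cancel₀ hα (by rw [hv, hγ, mul_one])))
  · have hq := one_add_sq_of_pow_twentyeight hu (mul_left_cancel₀ hα (hv.trans hγ))
    -- Completing the square leaves `y ^ 2 - y`, which equals `y ^ 4`.
    have hsq : (u + 1 + y) ^ 2 = (y ^ 2) ^ 2 := by
      linear_combination hq - y * hy + (y * u + y) * h3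
    have hF : (u + 1 + y) ^ 27 = u ^ 27 + 1 + y := by
      have h1 : (u + 1 + y) ^ 27 = (u + 1) ^ 27 + y ^ 27 := add_pow_char_pow (p := 3) (n := 3) _ _
      have h2 : (u + 1) ^ 27 = u ^ 27 + 1 ^ 27 := add_pow_char_pow (p := 3) (n := 3) _ _
      rw [h1, h2, hy27, one_pow]
    have hu27 : u ^ 27 = u := by
      rcases sq_eq_sq_iff_eq_or_eq_neg.1 hsq with h | h
      · rw [h, pow_right_comm, hy27] at hF
        linear_combination -hF - h
      · rw [h, Odd.neg_pow (by decide), pow_right_comm, hy27] at hF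
        linear_combination -hF - h
    have := hneg hu27
    rw [this] at hq
    exact hy0 (by linear_combination hq)
  · have hq := one_add_sq_of_pow_twentyeight hu (r := (1 + u) ^ 28) rfl
    have hr : (1 + u) ^ 28 * y = 1 := by
      refine mul_left_cancel₀ hα ?_
      rw [← mul_assoc, hv, hγ, mul_one]
    have hq' : y * (1 + u) ^ 2 = u := by linear_combination y * hq + u * hr
    -- Completing the square leaves `1 - y = -y ^ 3`, which is `y ^ 16` because `y ^ 13 = -1`.
    have hsq : (y * u + y + 1) ^ 2 = (y ^ 8) ^ 2 := by
      linear_combination y * hq' + hy - y ^ 3 * hy13 + (y * u + y) * h3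
    have hF : (y * u + y + 1) ^ 27 = y * u ^ 27 + y + 1 := by
      have h1 : (y * u + y + 1) ^ 27 = (y * u + y) ^ 27 + 1 ^ 27 :=
        add_pow_char_pow (p := 3) (n := 3) _ _
      have h2 : (y * u + y) ^ 27 = (y * u) ^ 27 + y ^ 27 := add_pow_char_pow (p := 3) (n := 3) _ _
      rw [h1, h2, mul_pow, hy27, one_pow]
    have hu27 : u ^ 27 = u := by
      refine mul_left_cancel₀ hy0 ?_
      rcases sq_eq_sq_iff_eq_or_eq_neg.1 hsq with h | h
      · rw [h, pow_right_comm, hy27] at hF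
        linear_combination -hF - h
      · rw [h, Odd.neg_pow (by decide), pow_right_comm, hy27] at hF
        linear_combination -hF - h
    have := hneg hu27
    rw [this] at hq'
    exact one_ne_zero (α := F) (by linear_combination hq')
theorem isCapThree_setOf_pow_twentyeight_eq_or {α : F} (hα : α ≠ 0) :
    IsCapThree {z : F | z ^ 28 = α ∨ z ^ 28 = α * y} := by
  have hy0 : y ≠ 0 := by
    rintro rfl
    exact one_ne_zero (α := F) (by linear_combination hy)
  have hαy : α * y ≠ 0 := mul_ne_zero hα hy0
  intro a ha b hb c hc hab hac hbc h
  have hac' : a + c + b = 0 := by rw [← h]; ring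
  have hbc' : b + c + a = 0 := by rw [← h]; ring
  rcases ha with ha | ha <;> rcases hb with hb | hb <;> rcases hc with hc | hc
  · exact (ne_of_pow_three hy hα hab h ha hb hc).1 rfl
  · exact (ne_of_pow_three hy hα hab h ha hb hc).2.1 rfl
  · exact (ne_of_pow_three hy hα hac hac' ha hc hb).2.1 rfl
  · exact (ne_of_pow_three hy hαy hbc hbc' hb hc ha).2.2 rfl
  · exact (ne_of_pow_three hy hα hbc hbc' hb hc ha).2.1 rfl
  · exact (ne_of_pow_three hy hαy hac hac' ha hc hb).2.2 rfl
  · exact (ne_of_pow_three hy hαy hab h ha hb hc).2.2 rfl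
  · exact (ne_of_pow_three hy hαy hab h ha hb hc).1 rfl

end ArtinSchreier

end CharThree

/-- A root in the algebraic closure is fixed by the 27th power map, hence by the 729th, and so lies
in `F`. -/
theorem exists_pow_three_eq_sub_one {F : Type*} [Field F] (h : Nat.card F = 729) :
    ∃ y : F, y ^ 3 = y - 1 := by
  have : Finite F := Nat.finite_of_card_ne_zero (by rw [h]; norm_num)
  have : Fintype F := Fintype.ofFinite F
  have : CharP F 3 := charP_of_natCard_eq_prime_pow (n := 6) h
  let K := AlgebraicClosure F
  have : CharP K 3 := charP_of_injective_algebraMap (algebraMap F K).injective 3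
  obtain ⟨z, hz⟩ : ∃ z : K, z ^ 3 = z - 1 := by
    obtain ⟨z, hz⟩ := IsAlgClosed.exists_root (Polynomial.X ^ 3 - Polynomial.X + 1 : Polynomial K)
      (by
        have : (Polynomial.X ^ 3 - Polynomial.X + 1 : Polynomial K).degree = 3 := by
          compute_degree!
        rw [this]
        norm_num)
    refine ⟨z, ?_⟩
    simp only [Polynomial.IsRoot.def, Polynomial.eval_add, Polynomial.eval_sub,
      Polynomial.eval_pow, Polynomial.eval_X, Polynomial.eval_one] at hz
    linear_combination hz
  have h27 := pow_twentyseven_of_pow_three hz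
  have h729 : z ^ Nat.card F = z := by
    rw [h, show 729 = 27 * 27 from rfl, pow_mul, h27, h27]
  obtain ⟨y, hy⟩ : ∃ y : F, algebraMap F K y = z := by
    refine Polynomial.splits_X_pow_nat_card_sub_X.mem_range_of_isRoot
      (FiniteField.X_pow_card_sub_X_ne_zero F Finite.one_lt_card) ?_
    rw [Nat.card_eq_fintype_card] at h729
    simp [h729]
  refine ⟨y, (algebraMap F K).injective ?_⟩
  simp [hy, hz]

/-! ### Counting functionals that vanish on given vectors. -/

theorem card_dual_le_ker {V : Type*} [AddCommGroup V] [Module (ZMod 3) V] [Finite V]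
    {n k : ℕ} (hn : Module.finrank (ZMod 3) V = n + k) {W : Submodule (ZMod 3) V}
    (hW : Module.finrank (ZMod 3) W = k) :
    Nat.card {φ : Module.Dual (ZMod 3) V // ∀ w ∈ W, φ w = 0} = 3 ^ n := by
  have : Module.Finite (ZMod 3) V := Module.Finite.of_finite
  have h := Subspace.finrank_add_finrank_dualAnnihilator_eq W
  have e : Nat.card {φ : Module.Dual (ZMod 3) V // ∀ w ∈ W, φ w = 0} =
      Nat.card W.dualAnnihilator :=
    Nat.card_congr (Equiv.subtypeEquivRight fun φ => (Submodule.mem_dualAnnihilator φ).symm)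
  rw [e, Module.natCard_eq_pow_finrank (K := ZMod 3), Nat.card_zmod]
  congr 1
  omega

theorem card_dual_eq_of_ne {V : Type*} [AddCommGroup V] [Module (ZMod 3) V] [Finite V]
    {n : ℕ} (hn : Module.finrank (ZMod 3) V = n + 1) {v : V} (hv : v ≠ 0) :
    Nat.card {φ : Module.Dual (ZMod 3) V // φ v = 0} = 3 ^ n := by
  rw [← card_dual_le_ker hn (finrank_span_singleton (K := ZMod 3) hv)]
  refine Nat.card_congr (Equiv.subtypeEquivRight fun φ => ?_)
  constructor
  · intro h w hw
    obtain ⟨c, rfl⟩ := Submodule.mem_span_singleton.1 hw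
    rw [map_smul, h, smul_zero]
  · exact fun h => h v (Submodule.mem_span_singleton_self v)

theorem card_dual_eq_of_linearIndependent {V : Type*} [AddCommGroup V] [Module (ZMod 3) V]
    [Finite V] {n : ℕ} (hn : Module.finrank (ZMod 3) V = n + 2) {v w : V}
    (h : LinearIndependent (ZMod 3) ![v, w]) :
    Nat.card {φ : Module.Dual (ZMod 3) V // φ v = 0 ∧ φ w = 0} = 3 ^ n := by
  have hW : Module.finrank (ZMod 3) (Submodule.span (ZMod 3) (Set.range ![v, w])) = 2 := by
    rw [finrank_span_eq_card h, Fintype.card_fin]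
  rw [← card_dual_le_ker hn hW]
  refine Nat.card_congr (Equiv.subtypeEquivRight fun φ => ?_)
  rw [Matrix.range_cons_cons_empty]
  constructor
  · rintro ⟨hv, hw⟩ x hx
    obtain ⟨a, b, rfl⟩ := Submodule.mem_span_pair.1 hx
    rw [map_add, map_smul, map_smul, hv, hw, smul_zero, smul_zero, add_zero]
  · exact fun h => ⟨h v (Submodule.subset_span (by simp)), h w (Submodule.subset_span (by simp))⟩

/-- A finite set in a vector space over `ZMod 3` that contains no three distinct elements with
sum zero, i.e. no affine line. -/
def SumThreeFree {V : Type*} [AddCommGroup V] (S : Finset V) : Prop :=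
  ∀ a ∈ S, ∀ b ∈ S, ∀ c ∈ S, a ≠ b → a ≠ c → b ≠ c → a + b + c ≠ 0

theorem SumThreeFree.subset {V : Type*} [AddCommGroup V] {S T : Finset V} (hT : SumThreeFree T)
    (h : S ⊆ T) : SumThreeFree S :=
  fun a ha b hb c hc => hT a (h ha) b (h hb) c (h hc)

theorem three_nsmul_eq_zero {V : Type*} [AddCommGroup V] [Module (ZMod 3) V] (v : V) :
    v + v + v = 0 := by
  have h : ((1 : ZMod 3) + 1 + 1) • v = 0 := by
    rw [show (1 : ZMod 3) + 1 + 1 = 0 by decide, zero_smul]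
  rwa [add_smul, add_smul, one_smul] at h

/-- Over three elements, a dependence between the two differences puts `x`, `y`, `z` on an affine
line, and the three points of a line sum to zero. -/
theorem SumThreeFree.linearIndependent {V : Type*} [AddCommGroup V] [Module (ZMod 3) V]
    {S : Finset V} (hS : SumThreeFree S) {x y z : V} (hx : x ∈ S) (hy : y ∈ S) (hz : z ∈ S)
    (hyx : y ≠ x) (hzx : z ≠ x) (hzy : z ≠ y) :
    LinearIndependent (ZMod 3) ![y - x, z - x] := by
  rw [LinearIndependent.pair_iff' (sub_ne_zero.2 hyx)]
  intro a ha
  have key : ∀ b : ZMod 3, b = 0 ∨ b = 1 ∨ b = -1 := by decide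
  rcases key a with rfl | rfl | rfl
  · rw [zero_smul] at ha
    exact hzx (sub_eq_zero.1 ha.symm)
  · rw [one_smul] at ha
    exact hzy (sub_left_injective ha).symm
  · refine hS x hx y hy z hz hyx.symm hzx.symm hzy.symm ?_
    rw [neg_one_smul] at ha
    have h3 := three_nsmul_eq_zero x
    have hz' : z = x + x - y := by
      rw [← sub_add_cancel z x, ← ha]
      abel
    rw [hz', ← h3]
    abel

/-! ### Moments of hyperplane sections of a cap. -/

section Moments

variable {V : Type*} [AddCommGroup V] [Module (ZMod 3) V]

theorem sum_card_fiber_pow (S : Finset V) (φ : Module.Dual (ZMod 3) V) (k : ℕ) :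
    ∑ c, (S.filter (φ · = c)).card ^ (k + 1) = ∑ x ∈ S, (S.filter (φ · = φ x)).card ^ k := by
  rw [← Finset.sum_fiberwise S φ]
  refine Finset.sum_congr rfl fun c _ => ?_
  rw [Finset.sum_congr rfl (g := fun _ => (S.filter (φ · = c)).card ^ k), Finset.sum_const,
    smul_eq_mul, pow_succ']
  intro x hx
  rw [(Finset.mem_filter.1 hx).2]

theorem sum_card_fiber (S : Finset V) (φ : Module.Dual (ZMod 3) V) :
    ∑ c, (S.filter (φ · = c)).card = S.card :=
  (Finset.card_eq_sum_card_fiberwise (fun _ _ => Finset.mem_coe.2 (Finset.mem_univ _))).symm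

theorem sum_card_fiber_zero_pow (S : Finset V) (k : ℕ) :
    ∑ c, (S.filter ((0 : Module.Dual (ZMod 3) V) · = c)).card ^ (k + 1) = S.card ^ (k + 1) := by
  rw [sum_card_fiber_pow]
  simp [pow_succ']

/-- Translating by a point `t` of `T` moves `T` into `W`, and sums of three points are unchanged
because `t + t + t = 0`. -/
theorem SumThreeFree.card_fiber_le [DecidableEq V] {k : ℕ} {W : Submodule (ZMod 3) V}
    (hk : ∀ T : Finset W, SumThreeFree T → T.card ≤ k) {S : Finset V} (hS : SumThreeFree S)
    {T : Finset V} (hTS : T ⊆ S) (hT : ∀ x ∈ T, ∀ y ∈ T, x - y ∈ W) : T.card ≤ k := by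
  rcases T.eq_empty_or_nonempty with rfl | ⟨t, ht⟩
  · simp
  · have := hk (T.attach.image fun x : T => (⟨x - t, hT x x.2 t ht⟩ : W)) ?_
    · rw [Finset.card_image_of_injective, Finset.card_attach] at this
      · exact this
      · intro x y hxy
        exact Subtype.ext (sub_left_injective (Subtype.ext_iff.1 hxy))
    · intro a ha b hb c hc hab hac hbc h
      obtain ⟨x, -, rfl⟩ := Finset.mem_image.1 ha
      obtain ⟨y, -, rfl⟩ := Finset.mem_image.1 hb
      obtain ⟨z, -, rfl⟩ := Finset.mem_image.1 hc
      refine hS x (hTS x.2) y (hTS y.2) z (hTS z.2) (fun e => hab ?_) (fun e => hac ?_)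
        (fun e => hbc ?_) ?_
      · simp only [e]
      · simp only [e]
      · simp only [e]
      · have h' : (x : V) - t + (y - t) + (z - t) = 0 := Subtype.ext_iff.1 h
        rw [← h', eq_comm, ← sub_zero ((x : V) + y + z), ← three_nsmul_eq_zero t]
        abel

theorem SumThreeFree.exists_fiber_cards [DecidableEq V] {n k : ℕ} [Finite V]
    (hn : Module.finrank (ZMod 3) V = n + 1)
    (hk : ∀ W : Submodule (ZMod 3) V, Module.finrank (ZMod 3) W = n →
      ∀ T : Finset W, SumThreeFree T → T.card ≤ k)
    {S : Finset V} (hS : SumThreeFree S) {φ : Module.Dual (ZMod 3) V} (hφ : φ ≠ 0) :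
    ∃ a b c : ℕ, a ≤ k ∧ b ≤ k ∧ c ≤ k ∧ a + b + c = S.card ∧
      ∀ j, ∑ c, (S.filter (φ · = c)).card ^ j = a ^ j + b ^ j + c ^ j := by
  have : Module.Finite (ZMod 3) V := Module.Finite.of_finite
  have hker : Module.finrank (ZMod 3) (LinearMap.ker φ) = n := by
    have := Module.Dual.finrank_ker_add_one_of_ne_zero hφ
    omega
  have hle : ∀ c, (S.filter (φ · = c)).card ≤ k := by
    intro c
    refine hS.card_fiber_le (hk _ hker) (Finset.filter_subset _ _) fun x hx y hy => ?_
    rw [LinearMap.mem_ker, map_sub, (Finset.mem_filter.1 hx).2, (Finset.mem_filter.1 hy).2, sub_self]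
  have hsum : ∀ f : ZMod 3 → ℕ, ∑ c, f c = f 0 + f 1 + f 2 := fun f => Fin.sum_univ_three f
  exact ⟨_, _, _, hle 0, hle 1, hle 2, (hsum _).symm.trans (sum_card_fiber S φ), fun j => hsum _⟩

variable [DecidableEq V] [Fintype V] [Fintype (Module.Dual (ZMod 3) V)] {n : ℕ}

theorem sum_dual_boole_eq (hn : Module.finrank (ZMod 3) V = n + 1) (x y : V) :
    ∑ φ : Module.Dual (ZMod 3) V, (if φ y = φ x then 1 else 0) =
      if y = x then 3 ^ (n + 1) else 3 ^ n := by
  rw [← Finset.card_filter]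
  split_ifs with h
  · subst h
    have : Module.Finite (ZMod 3) V := Module.Finite.of_finite
    rw [Finset.filter_true_of_mem (fun _ _ => rfl), Finset.card_univ, ← Nat.card_eq_fintype_card,
      Module.natCard_eq_pow_finrank (K := ZMod 3), Nat.card_zmod, Subspace.dual_finrank_eq, hn]
  · rw [← card_dual_eq_of_ne hn (sub_ne_zero.2 h), Nat.card_eq_fintype_card, Fintype.card_subtype]
    simp only [map_sub, sub_eq_zero]

theorem sum_dual_sum_card_fiber_sq (hn : Module.finrank (ZMod 3) V = n + 1) (S : Finset V) :
    ∑ φ : Module.Dual (ZMod 3) V, ∑ c, (S.filter (φ · = c)).card ^ 2 =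
      S.card * (3 ^ (n + 1) + (S.card - 1) * 3 ^ n) := by
  simp only [sum_card_fiber_pow S _ 1, pow_one]
  rw [Finset.sum_comm, ← smul_eq_mul, ← Finset.sum_const]
  refine Finset.sum_congr rfl fun x hx => ?_
  simp only [Finset.card_filter]
  rw [Finset.sum_comm]
  simp only [sum_dual_boole_eq hn]
  rw [← Finset.add_sum_erase S _ hx, if_pos rfl, ← Finset.card_erase_of_mem hx, ← smul_eq_mul,
    ← Finset.sum_const]
  congr 1
  exact Finset.sum_congr rfl fun y hy => if_neg (Finset.ne_of_mem_erase hy)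

omit [DecidableEq V] in
theorem sum_dual_boole_and_eq (hn : Module.finrank (ZMod 3) V = n + 2) {x y z : V}
    (h : LinearIndependent (ZMod 3) ![y - x, z - x]) :
    ∑ φ : Module.Dual (ZMod 3) V, (if φ y = φ x ∧ φ z = φ x then 1 else 0) = 3 ^ n := by
  rw [← Finset.card_filter, ← card_dual_eq_of_linearIndependent hn h, Nat.card_eq_fintype_card,
    Fintype.card_subtype]
  simp only [map_sub, sub_eq_zero]

/-- Count triples of points on which `φ` is constant. Distinct points of a cap are never collinear,
so each triple imposes as many independent conditions on `φ` as its number of distinct points less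
one, and the total depends only on the size of `S`. -/
theorem SumThreeFree.sum_dual_sum_card_fiber_cube (hn : Module.finrank (ZMod 3) V = n + 2)
    {S : Finset V} (hS : SumThreeFree S) :
    ∑ φ : Module.Dual (ZMod 3) V, ∑ c, (S.filter (φ · = c)).card ^ 3 =
      S.card * ((3 ^ (n + 2) + (S.card - 1) * 3 ^ (n + 1)) +
        (S.card - 1) * (3 ^ (n + 1) + (3 ^ (n + 1) + (S.card - 1 - 1) * 3 ^ n))) := by
  simp only [sum_card_fiber_pow S _ 2]
  rw [Finset.sum_comm, ← smul_eq_mul, ← Finset.sum_const]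
  refine Finset.sum_congr rfl fun x hx => ?_
  have e : ∀ φ : Module.Dual (ZMod 3) V, (S.filter (φ · = φ x)).card ^ 2 =
      ∑ y ∈ S, ∑ z ∈ S, if φ y = φ x ∧ φ z = φ x then 1 else 0 := by
    intro φ
    rw [sq, Finset.card_filter, Finset.sum_mul_sum]
    refine Finset.sum_congr rfl fun y _ => Finset.sum_congr rfl fun z _ => ?_
    by_cases h1 : φ y = φ x <;> by_cases h2 : φ z = φ x <;> simp [h1, h2]
  simp only [e]
  rw [Finset.sum_comm]
  have e2 : ∀ y, ∑ φ : Module.Dual (ZMod 3) V, ∑ z ∈ S, (if φ y = φ x ∧ φ z = φ x then 1 else 0) =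
      ∑ z ∈ S, ∑ φ : Module.Dual (ZMod 3) V, (if φ y = φ x ∧ φ z = φ x then 1 else 0) :=
    fun y => Finset.sum_comm
  simp only [e2]
  rw [← Finset.add_sum_erase S _ hx]
  congr 1
  · simp only [true_and, sum_dual_boole_eq (n := n + 1) hn]
    rw [← Finset.add_sum_erase S _ hx, if_pos rfl, ← Finset.card_erase_of_mem hx, ← smul_eq_mul,
      ← Finset.sum_const]
    congr 1
    exact Finset.sum_congr rfl fun y hy => if_neg (Finset.ne_of_mem_erase hy)
  · rw [← Finset.card_erase_of_mem hx, ← smul_eq_mul, ← Finset.sum_const]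
    refine Finset.sum_congr rfl fun y hy => ?_
    have hyx := Finset.ne_of_mem_erase hy
    have hyS := Finset.mem_of_mem_erase hy
    rw [← Finset.add_sum_erase S _ hx, ← Finset.add_sum_erase (S.erase x) _ hy]
    congr 1
    · simp only [and_true, sum_dual_boole_eq (n := n + 1) hn, if_neg hyx]
    · congr 1
      · simp only [and_self, sum_dual_boole_eq (n := n + 1) hn, if_neg hyx]
      · rw [← Finset.card_erase_of_mem hy, ← smul_eq_mul, ← Finset.sum_const]
        refine Finset.sum_congr rfl fun z hz => ?_
        have hz' := Finset.mem_of_mem_erase hz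
        exact sum_dual_boole_and_eq hn (hS.linearIndependent hx hyS (Finset.mem_of_mem_erase hz') hyx
          (Finset.ne_of_mem_erase hz') (Finset.ne_of_mem_erase hz))

end Moments

/-! ### Cap bounds in dimensions one to four. -/

theorem SumThreeFree.card_le_two {V : Type*} [AddCommGroup V] [Module (ZMod 3) V] [Finite V]
    (hn : Module.finrank (ZMod 3) V = 1) {S : Finset V} (hS : SumThreeFree S) : S.card ≤ 2 := by
  classical
  have := Fintype.ofFinite V
  by_contra! h
  have hV : Fintype.card V = 3 := by
    rw [← Nat.card_eq_fintype_card, Module.natCard_eq_pow_finrank (K := ZMod 3), hn, Nat.card_zmod,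
      pow_one]
  have hU : S = Finset.univ := Finset.eq_univ_of_card _ (by
    have := Finset.card_le_univ S
    omega)
  obtain ⟨v, hv⟩ : ∃ v : V, v ≠ 0 := by
    have : Nontrivial V := Fintype.one_lt_card_iff_nontrivial.1 (by omega)
    exact exists_ne 0
  have h3 := three_nsmul_eq_zero v
  have hvv : v ≠ -v := by
    intro e
    rw [eq_neg_iff_add_eq_zero] at e
    rw [e, zero_add] at h3
    exact hv h3
  refine hS 0 ?_ v ?_ (-v) ?_ hv.symm (neg_ne_zero.2 hv).symm hvv (by simp) <;> simp [hU]

theorem SumThreeFree.card_le_four {V : Type*} [AddCommGroup V] [Module (ZMod 3) V] [Finite V]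
    (hn : Module.finrank (ZMod 3) V = 2) {S : Finset V} (hS : SumThreeFree S) : S.card ≤ 4 := by
  classical
  by_contra! h
  obtain ⟨T, hTS, hT⟩ := Finset.exists_subset_card_eq h
  replace hS := hS.subset hTS
  have := Fintype.ofFinite V
  have : Module.Finite (ZMod 3) V := Module.Finite.of_finite
  have : Finite (Module.Dual (ZMod 3) V) := Module.finite_of_finite (ZMod 3)
  have := Fintype.ofFinite (Module.Dual (ZMod 3) V)
  have hcard : Fintype.card (Module.Dual (ZMod 3) V) = 9 := by
    rw [← Nat.card_eq_fintype_card, Module.natCard_eq_pow_finrank (K := ZMod 3), Nat.card_zmod,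
      Subspace.dual_finrank_eq, hn]
    rfl
  have h2 := sum_dual_sum_card_fiber_sq (n := 1) hn T
  rw [← Finset.add_sum_erase _ _ (Finset.mem_univ 0), sum_card_fiber_zero_pow, hT] at h2
  -- Five points split into parts of size at most 2 only as 2, 2, 1, with squares summing to 9. The
  -- eight nonzero functionals then give at most 72, but the moment identity demands `105 - 25 =
  -- 80`.
  have hle : ∑ φ ∈ Finset.univ.erase (0 : Module.Dual (ZMod 3) V),
      ∑ c, (T.filter (φ · = c)).card ^ 2 ≤ (Finset.univ.erase (0 : Module.Dual (ZMod 3) V)).card • 9 := by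
    refine Finset.sum_le_card_nsmul _ _ _ fun φ hφ => ?_
    obtain ⟨a, b, c, ha, hb, hc, hs, hp⟩ := hS.exists_fiber_cards hn
      (fun W hW T hT => hT.card_le_two hW) (Finset.ne_of_mem_erase hφ)
    rw [hp]
    rw [hT] at hs
    interval_cases a <;> interval_cases b <;> interval_cases c <;> simp at hs ⊢
  rw [Finset.card_erase_of_mem (Finset.mem_univ _), Finset.card_univ, hcard] at hle
  norm_num at h2 hle
  omega

/-- The only splittings are 4, 4, 2 and 4, 3, 3; the coefficients 9 and 188 give the line through
their two (square sum, cube sum) pairs. -/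
theorem four_cap_fiber_arith : ∀ a b c : Fin 5, (a + b + c : ℕ) = 10 →
    9 * (a ^ 2 + b ^ 2 + c ^ 2 : ℕ) ≤ (a ^ 3 + b ^ 3 + c ^ 3 : ℕ) + 188 := by
  decide +kernel

theorem SumThreeFree.card_le_nine {V : Type*} [AddCommGroup V] [Module (ZMod 3) V] [Finite V]
    (hn : Module.finrank (ZMod 3) V = 3) {S : Finset V} (hS : SumThreeFree S) : S.card ≤ 9 := by
  classical
  by_contra! h
  obtain ⟨T, hTS, hT⟩ := Finset.exists_subset_card_eq h
  replace hS := hS.subset hTS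
  have := Fintype.ofFinite V
  have : Module.Finite (ZMod 3) V := Module.Finite.of_finite
  have : Finite (Module.Dual (ZMod 3) V) := Module.finite_of_finite (ZMod 3)
  have := Fintype.ofFinite (Module.Dual (ZMod 3) V)
  have hcard : Fintype.card (Module.Dual (ZMod 3) V) = 27 := by
    rw [← Nat.card_eq_fintype_card, Module.natCard_eq_pow_finrank (K := ZMod 3), Nat.card_zmod,
      Subspace.dual_finrank_eq, hn]
    rfl
  have h2 := sum_dual_sum_card_fiber_sq (n := 2) hn T
  have h3 := hS.sum_dual_sum_card_fiber_cube (n := 1) hn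
  rw [← Finset.add_sum_erase _ _ (Finset.mem_univ 0), sum_card_fiber_zero_pow, hT] at h2 h3
  -- Over the 26 nonzero functionals the moments make the left side `9 * 980 = 8820` and the right
  -- side `3860 + 26 * 188 = 8748`.
  have hle : ∑ φ ∈ Finset.univ.erase (0 : Module.Dual (ZMod 3) V),
      9 * ∑ c, (T.filter (φ · = c)).card ^ 2 ≤
      ∑ φ ∈ Finset.univ.erase (0 : Module.Dual (ZMod 3) V),
        (∑ c, (T.filter (φ · = c)).card ^ 3 + 188) := by
    refine Finset.sum_le_sum fun φ hφ => ?_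
    obtain ⟨a, b, c, ha, hb, hc, hs, hp⟩ := hS.exists_fiber_cards hn
      (fun W hW T hT => hT.card_le_four hW) (Finset.ne_of_mem_erase hφ)
    rw [hp, hp]
    rw [hT] at hs
    exact four_cap_fiber_arith ⟨a, Nat.lt_succ_of_le ha⟩ ⟨b, Nat.lt_succ_of_le hb⟩
      ⟨c, Nat.lt_succ_of_le hc⟩ hs
  rw [Finset.sum_add_distrib, ← Finset.mul_sum, Finset.sum_const,
    Finset.card_erase_of_mem (Finset.mem_univ _), Finset.card_univ, hcard] at hle
  norm_num at h2 h3 hle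
  omega

/-- The coefficients give the line through the (square sum, cube sum) pairs of the splittings 7, 7,
7 and 9, 9, 3; every other splitting is strict. -/
theorem nine_cap_fiber_arith : ∀ a b c : Fin 10, (a + b + c : ℕ) = 21 →
    19 * (a ^ 2 + b ^ 2 + c ^ 2 : ℕ) ≤ (a ^ 3 + b ^ 3 + c ^ 3 : ℕ) + 1764 ∧
    (19 * (a ^ 2 + b ^ 2 + c ^ 2 : ℕ) = (a ^ 3 + b ^ 3 + c ^ 3 : ℕ) + 1764 →
      (a ^ 2 + b ^ 2 + c ^ 2 : ℕ) = 147 ∨ (a ^ 2 + b ^ 2 + c ^ 2 : ℕ) = 171) := by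
  decide +kernel

theorem SumThreeFree.card_le_twenty {V : Type*} [AddCommGroup V] [Module (ZMod 3) V] [Finite V]
    (hn : Module.finrank (ZMod 3) V = 4) {S : Finset V} (hS : SumThreeFree S) : S.card ≤ 20 := by
  classical
  by_contra! h
  obtain ⟨T, hTS, hT⟩ := Finset.exists_subset_card_eq h
  replace hS := hS.subset hTS
  have := Fintype.ofFinite V
  have : Module.Finite (ZMod 3) V := Module.Finite.of_finite
  have : Finite (Module.Dual (ZMod 3) V) := Module.finite_of_finite (ZMod 3)
  have := Fintype.ofFinite (Module.Dual (ZMod 3) V)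
  have hcard : Fintype.card (Module.Dual (ZMod 3) V) = 81 := by
    rw [← Nat.card_eq_fintype_card, Module.natCard_eq_pow_finrank (K := ZMod 3), Nat.card_zmod,
      Subspace.dual_finrank_eq, hn]
    rfl
  have h2 := sum_dual_sum_card_fiber_sq (n := 3) hn T
  have h3 := hS.sum_dual_sum_card_fiber_cube (n := 2) hn
  rw [← Finset.add_sum_erase _ _ (Finset.mem_univ 0), sum_card_fiber_zero_pow, hT] at h2 h3
  set D := Finset.univ.erase (0 : Module.Dual (ZMod 3) V)
  have hD : D.card = 80 := by
    rw [Finset.card_erase_of_mem (Finset.mem_univ _), Finset.card_univ, hcard]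
  have harith : ∀ φ ∈ D, 19 * ∑ c, (T.filter (φ · = c)).card ^ 2 ≤
      ∑ c, (T.filter (φ · = c)).card ^ 3 + 1764 ∧
      (19 * ∑ c, (T.filter (φ · = c)).card ^ 2 = ∑ c, (T.filter (φ · = c)).card ^ 3 + 1764 →
      ∑ c, (T.filter (φ · = c)).card ^ 2 = 147 ∨ ∑ c, (T.filter (φ · = c)).card ^ 2 = 171) := by
    intro φ hφ
    obtain ⟨a, b, c, ha, hb, hc, hs, hp⟩ := hS.exists_fiber_cards hn
      (fun W hW T hT => hT.card_le_nine hW) (Finset.ne_of_mem_erase hφ)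
    rw [hp, hp]
    rw [hT] at hs
    exact nine_cap_fiber_arith ⟨a, Nat.lt_succ_of_le ha⟩ ⟨b, Nat.lt_succ_of_le hb⟩
      ⟨c, Nat.lt_succ_of_le hc⟩ hs
  -- The moments are 12600 and 98280, and `19 * 12600 = 98280 + 80 * 1764`, so no functional can be
  -- strict.
  have heq : ∑ φ ∈ D, 19 * ∑ c, (T.filter (φ · = c)).card ^ 2 =
      ∑ φ ∈ D, (∑ c, (T.filter (φ · = c)).card ^ 3 + 1764) := by
    rw [Finset.sum_add_distrib, ← Finset.mul_sum, Finset.sum_const, hD]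
    norm_num at h2 h3 ⊢
    omega
  have hor : ∀ φ ∈ D, ∑ c, (T.filter (φ · = c)).card ^ 2 = 147 ∨
      ∑ c, (T.filter (φ · = c)).card ^ 2 = 171 := fun φ hφ =>
    (harith φ hφ).2 ((Finset.sum_eq_sum_iff_of_le fun φ hφ => (harith φ hφ).1).1 heq φ hφ)
  -- From `12600 = 80 * 147 + 24 * 35`. This odd count is impossible, since `φ` and `-φ` have the
  -- same fibre sizes up to order.
  have h35 : ∑ φ ∈ D, (if ∑ c, (T.filter (φ · = c)).card ^ 2 = 171 then 1 else 0) = 35 := by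
    have : ∑ φ ∈ D, ∑ c, (T.filter (φ · = c)).card ^ 2 = ∑ φ ∈ D,
        (147 + 24 * (if ∑ c, (T.filter (φ · = c)).card ^ 2 = 171 then 1 else 0)) := by
      refine Finset.sum_congr rfl fun φ hφ => ?_
      rcases hor φ hφ with e | e <;> rw [e] <;> rfl
    rw [Finset.sum_add_distrib, ← Finset.mul_sum, Finset.sum_const, hD] at this
    norm_num at h2 this ⊢
    omega
  have heven : ∑ φ ∈ D, (if ∑ c, (T.filter (φ · = c)).card ^ 2 = 171 then (1 : ZMod 2) else 0) = 0 := by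
    refine Finset.sum_involution (fun φ _ => -φ) ?_ ?_ ?_ ?_
    · intro φ hφ
      have : ∑ c, (T.filter ((-φ) · = c)).card ^ 2 = ∑ c, (T.filter (φ · = c)).card ^ 2 := by
        rw [sum_card_fiber_pow T _ 1, sum_card_fiber_pow T _ 1]
        simp only [LinearMap.neg_apply, neg_inj]
      rw [this]
      exact CharTwo.add_self_eq_zero _
    · intro φ hφ _ e
      refine Finset.ne_of_mem_erase hφ ?_
      have h3 := three_nsmul_eq_zero φ
      nth_rewrite 1 [← e] at h3
      rwa [neg_add_cancel, zero_add] at h3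
    · intro φ hφ
      exact Finset.mem_erase.2 ⟨neg_ne_zero.2 (Finset.ne_of_mem_erase hφ), Finset.mem_univ _⟩
    · intro φ hφ
      exact neg_neg φ
  have hcast := congrArg (Nat.cast : ℕ → ZMod 2) h35
  push_cast at hcast
  rw [heven] at hcast
  revert hcast
  decide

theorem IsCapThree.ncard_le_twenty {F : Type*} [Field F] (h : Nat.card F = 81) {S : Set F}
    (hS : IsCapThree S) : S.ncard ≤ 20 := by
  have : Finite F := Nat.finite_of_card_ne_zero (by rw [h]; norm_num)
  have : CharP F 3 := charP_of_natCard_eq_prime_pow (n := 4) h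
  let _ : Algebra (ZMod 3) F := ZMod.algebra F 3
  have : Module.Finite (ZMod 3) F := Module.Finite.of_finite
  have hn : Module.finrank (ZMod 3) F = 4 := by
    have := Module.natCard_eq_pow_finrank (K := ZMod 3) (V := F)
    rw [h, Nat.card_zmod] at this
    exact (Nat.pow_right_injective (by norm_num)
      (show 3 ^ 4 = 3 ^ Module.finrank (ZMod 3) F from this)).symm
  rw [Set.ncard_eq_toFinset_card S (Set.toFinite S)]
  refine SumThreeFree.card_le_twenty hn fun a ha b hb c hc => ?_
  rw [Set.Finite.mem_toFinset] at ha hb hc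
  exact hS a ha b hb c hc

/-! ### Completeness in order 243. -/

theorem neg_one_ne_sq_of_natCard {F : Type*} [Field F] (h : Nat.card F = 243) (x : F) :
    x ^ 2 ≠ -1 := by
  intro hx
  have : Finite F := Nat.finite_of_card_ne_zero (by rw [h]; norm_num)
  have : CharP F 3 := charP_of_natCard_eq_prime_pow (n := 5) h
  have hx0 : x ≠ 0 := by
    rintro rfl
    simp at hx
  have h1 := pow_natCard_sub_one_eq_one hx0
  rw [h, show 243 - 1 = 2 * 121 from rfl, pow_mul, hx, Odd.neg_one_pow (by decide)] at h1
  exact two_ne_zero_of_charP_three (F := F) (by linear_combination -h1)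

/-- Put `σ = u + u⁻¹ + 1` and `τ = v + v⁻¹ + 1`; equality would mean `σ * τ = 1`. Since `w ^ 27 = w
^ 5`, Frobenius acts on such elements as a quintic polynomial, and applying it to `σ * τ = 1` gives
`σ ^ 2 + τ ^ 2 = ±1`. Every case ends in `u = -1` or a square root of `-1`. -/
theorem mul_ne_of_pow_twentytwo {F : Type*} [Field F] (h : Nat.card F = 243) {u v : F}
    (hu : u ^ 22 = 1) (hv : v ^ 22 = 1) (hu' : u ≠ -1) :
    (u ^ 2 + u + 1) * (v ^ 2 + v + 1) ≠ u * v := by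
  intro huv
  have : CharP F 3 := charP_of_natCard_eq_prime_pow (n := 5) h
  have h3 : (3 : F) = 0 := three_eq_zero_of_charP_three
  have key : ∀ w : F, w ^ 22 = 1 → w ≠ 0 ∧ ∃ σ : F, σ * w = w ^ 2 + w + 1 ∧
      σ ^ 27 = σ * (σ ^ 2 - σ - 1) ^ 2 := by
    intro w hw
    have hw0 : w ≠ 0 := by rintro rfl; simp at hw
    refine ⟨hw0, w + w⁻¹ + 1, by field_simp; ring, ?_⟩
    have h1 : (w + w⁻¹ + 1) ^ 27 = (w + w⁻¹) ^ 27 + 1 ^ 27 := add_pow_char_pow (p := 3) (n := 3) _ _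
    have h2 : (w + w⁻¹) ^ 27 = w ^ 27 + w⁻¹ ^ 27 := add_pow_char_pow (p := 3) (n := 3) _ _
    have h4 : w ^ 27 = w ^ 5 := by linear_combination w ^ 5 * hw
    rw [h1, h2, inv_pow, h4, ← inv_pow, one_pow]
    obtain ⟨z, hz, hz'⟩ : ∃ z, z = w⁻¹ ∧ w * z = 1 := ⟨_, rfl, mul_inv_cancel₀ hw0⟩
    rw [← hz]
    have h5 : w ^ 5 + z ^ 5 = (w + z) ^ 5 - 5 * (w + z) ^ 3 + 5 * (w + z) := by
      have e2 : w ^ 2 + z ^ 2 = (w + z) ^ 2 - 2 := by linear_combination -2 * hz'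
      have e3 : w ^ 3 + z ^ 3 = (w + z) ^ 3 - 3 * (w + z) := by
        linear_combination -3 * (w + z) * hz'
      have e5 : w ^ 5 + z ^ 5 = (w ^ 2 + z ^ 2) * (w ^ 3 + z ^ 3) - (w + z) := by
        linear_combination -(w + z) * (w * z + 1) * hz'
      rw [e5, e2, e3]
      ring
    rw [h5]
    generalize w + z = s
    linear_combination (-s ^ 4 - 2 * s ^ 3 + s ^ 2 + 2 * s) * h3
  obtain ⟨hu0, σ, hσ, hσ27⟩ := key u hu
  obtain ⟨hv0, τ, hτ, hτ27⟩ := key v hv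
  have hστ : σ * τ = 1 := by
    refine mul_right_cancel₀ (mul_ne_zero hu0 hv0) ?_
    calc σ * τ * (u * v) = σ * u * (τ * v) := by ring
      _ = 1 * (u * v) := by rw [hσ, hτ, huv, one_mul]
  have hm : (σ ^ 2 + τ ^ 2) ^ 2 = 1 := by
    have e1 : σ ^ 27 * τ ^ 27 = 1 := by rw [← mul_pow, hστ, one_pow]
    have e2 : (σ ^ 2 - σ - 1) * (τ ^ 2 - τ - 1) = -(σ ^ 2 + τ ^ 2) := by
      linear_combination (σ * τ + 1 - σ - τ + 1) * hστ + h3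
    rw [hσ27, hτ27] at e1
    calc (σ ^ 2 + τ ^ 2) ^ 2 = ((σ ^ 2 - σ - 1) * (τ ^ 2 - τ - 1)) ^ 2 := by rw [e2]; ring
      _ = 1 := by
        linear_combination e1 - (σ ^ 2 - σ - 1) ^ 2 * (τ ^ 2 - τ - 1) ^ 2 * hστ
  rcases mul_self_eq_one_iff.1 ((sq _).symm.trans hm) with hm | hm
  · have : (σ + τ) ^ 2 = 0 := by linear_combination hm + 2 * hστ + h3
    have : σ + τ = 0 := pow_eq_zero_iff two_ne_zero |>.1 this
    exact neg_one_ne_sq_of_natCard h σ (by linear_combination σ * this - hστ)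
  · have : (σ + τ) ^ 2 = 1 := by linear_combination hm + 2 * hστ
    rcases mul_self_eq_one_iff.1 ((sq _).symm.trans this) with e | e
    · have : (σ + 1) ^ 2 = 0 := by linear_combination σ * e - hστ + σ * h3
      have hσ1 : σ + 1 = 0 := pow_eq_zero_iff two_ne_zero |>.1 this
      have : (u + 1) ^ 2 = 0 := by linear_combination u * hσ1 - hσ
      exact hu' (eq_neg_of_add_eq_zero_left (pow_eq_zero_iff two_ne_zero |>.1 this))
    · have : (σ - 1) ^ 2 = 0 := by linear_combination σ * e - hστ - σ * h3
      have hσ1 : σ - 1 = 0 := pow_eq_zero_iff two_ne_zero |>.1 this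
      exact neg_one_ne_sq_of_natCard h u (by linear_combination u * hσ1 - hσ)

/-- Frobenius turns `(1 + w) ^ 22` into a rational function with denominator `(1 + w) ^ 4`. Equality
of two values factors as `u - v`, `u * v - 1` and the factor excluded by `mul_ne_of_pow_twentytwo`.
-/
theorem eq_or_mul_eq_one_of_pow_twentytwo {F : Type*} [Field F] (h : Nat.card F = 243) {u v : F}
    (hu : u ^ 22 = 1) (hv : v ^ 22 = 1) (hu' : u ≠ -1) (hv' : v ≠ -1)
    (huv : (1 + u) ^ 22 = (1 + v) ^ 22) : u = v ∨ u * v = 1 := by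
  have : CharP F 3 := charP_of_natCard_eq_prime_pow (n := 5) h
  have h3 : (3 : F) = 0 := three_eq_zero_of_charP_three
  have key : ∀ w : F, w ^ 22 = 1 → w ≠ -1 → w ≠ 0 ∧ 1 + w ≠ 0 ∧
      (1 + w) ^ 4 * (1 + w) ^ 22 = w ^ 4 - w ^ 3 + w ^ 2 - w + 1 := by
    intro w hw hw'
    have hw1 : 1 + w ≠ 0 := fun e => hw' (eq_neg_of_add_eq_zero_right e)
    have h27 : (1 + w) ^ 27 = 1 + w ^ 27 := by
      simpa using add_pow_char_pow (p := 3) (n := 3) (1 : F) w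
    refine ⟨by rintro rfl; simp at hw, hw1, mul_left_cancel₀ hw1 ?_⟩
    linear_combination h27 + w ^ 5 * hw
  obtain ⟨hu0, hu1, hku⟩ := key u hu hu'
  obtain ⟨hv0, hv1, hkv⟩ := key v hv hv'
  have e : (1 + u) ^ 4 * (v ^ 4 - v ^ 3 + v ^ 2 - v + 1) =
      (1 + v) ^ 4 * (u ^ 4 - u ^ 3 + u ^ 2 - u + 1) := by
    rw [← hku, ← hkv, huv]
    ring
  have e' : (u - v) * (u * v - 1) * ((u ^ 2 + u + 1) * (v ^ 2 + v + 1) - u * v) = 0 := by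
    linear_combination e + 2 * (u - v) * (u * v - 1) *
      ((u ^ 2 + u + 1) * (v ^ 2 + v + 1) - u * v) * h3
  rcases mul_eq_zero.1 e' with e' | e'
  · rcases mul_eq_zero.1 e' with e' | e'
    · exact Or.inl (sub_eq_zero.1 e')
    · exact Or.inr (sub_eq_zero.1 e')
  · exact absurd (sub_eq_zero.1 e') (mul_ne_of_pow_twentytwo h hu hv hu')

theorem exists_pow_twentytwo_of_pow_eleven {F : Type*} [Field F] (h : Nat.card F = 243) {r : F}
    (hr : r ^ 11 = 1) (hr1 : r ≠ 1) : ∃ u : F, u ^ 22 = 1 ∧ u ≠ 1 ∧ (1 + u) ^ 22 = r := by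
  classical
  have : Finite F := Nat.finite_of_card_ne_zero (by rw [h]; norm_num)
  have := Fintype.ofFinite F
  have : CharP F 3 := charP_of_natCard_eq_prime_pow (n := 5) h
  have h2 : (2 : F) ≠ 0 := two_ne_zero_of_charP_three
  have h11 : (1 : F) ≠ -1 := fun e => h2 (by linear_combination e)
  have hA' : (Finset.univ.filter fun u : F => u ^ 22 = 1).card = 22 := by
    have := ncard_setOf_pow_eq_pow (d := 22) (k := 11) (by rw [h]) (one_ne_zero (α := F))
    rw [one_pow] at this
    refine Eq.trans ?_ this
    rw [← Set.ncard_coe_finset]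
    congr 1
    ext
    simp
  have hB' : (Finset.univ.filter fun u : F => u ^ 11 = 1).card = 11 := by
    have := ncard_setOf_pow_eq_pow (d := 11) (k := 22) (by rw [h]) (one_ne_zero (α := F))
    rw [one_pow] at this
    refine Eq.trans ?_ this
    rw [← Set.ncard_coe_finset]
    congr 1
    ext
    simp
  set A := ((Finset.univ.filter fun u : F => u ^ 22 = 1).erase 1).erase (-1) with hAdef
  set B := (Finset.univ.filter fun u : F => u ^ 11 = 1).erase 1 with hBdef
  have hA : A.card = 20 := by
    rw [hAdef, Finset.card_erase_of_mem, Finset.card_erase_of_mem, hA']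
    · simp
    · simp [h11.symm, Even.neg_one_pow (show Even 22 by decide)]
  have hB : B.card = 10 := by
    rw [hBdef, Finset.card_erase_of_mem, hB']
    simp
  have hmemA : ∀ u, u ∈ A ↔ u ≠ -1 ∧ u ≠ 1 ∧ u ^ 22 = 1 := by
    intro u
    simp [hAdef]
  -- Fibres lie in `{v, v⁻¹}`, so the 20 elements of `A` have at least 10 images, filling `B`.
  have himg : A.image (fun u => (1 + u) ^ 22) = B := by
    refine Finset.eq_of_subset_of_card_le ?_ ?_
    · intro r hr
      obtain ⟨u, hu, rfl⟩ := Finset.mem_image.1 hr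
      obtain ⟨hu1, hu2, hu⟩ := (hmemA u).1 hu
      rw [hBdef, Finset.mem_erase, Finset.mem_filter]
      refine ⟨fun e => hu2 (eq_one_of_pow_twentytwo hu e), Finset.mem_univ _, ?_⟩
      rw [← pow_mul]
      have := pow_natCard_sub_one_eq_one (x := 1 + u) (fun e => hu1 (eq_neg_of_add_eq_zero_right e))
      rwa [h] at this
    · have := Finset.card_le_mul_card_image (f := fun u : F => (1 + u) ^ 22) A 2 (by
        intro r hr
        obtain ⟨v, hv, rfl⟩ := Finset.mem_image.1 hr
        obtain ⟨hv1, hv2, hv⟩ := (hmemA v).1 hv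
        refine (Finset.card_le_card (t := {v, v⁻¹}) ?_).trans Finset.card_le_two
        intro u hu
        obtain ⟨hu, huv⟩ := Finset.mem_filter.1 hu
        obtain ⟨hu1, hu2, hu⟩ := (hmemA u).1 hu
        rw [Finset.mem_insert, Finset.mem_singleton]
        exact (eq_or_mul_eq_one_of_pow_twentytwo h hu hv hu1 hv1 huv).imp_right
          eq_inv_of_mul_eq_one_left)
      omega
  have hrB : r ∈ B := by
    rw [hBdef, Finset.mem_erase, Finset.mem_filter]
    exact ⟨hr1, Finset.mem_univ _, hr⟩
  rw [← himg] at hrB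
  obtain ⟨u, hu, hur⟩ := Finset.mem_image.1 hrB
  obtain ⟨-, hu1, hu⟩ := (hmemA u).1 hu
  exact ⟨u, hu, hu1, hur⟩

theorem isCompleteCapThree_setOf_pow_twentytwo {F : Type*} [Field F] (h : Nat.card F = 243) {x : F}
    (hx : x ≠ 0) : IsCompleteCapThree {z : F | z ^ 22 = x ^ 22} := by
  have : Finite F := Nat.finite_of_card_ne_zero (by rw [h]; norm_num)
  have : CharP F 3 := charP_of_natCard_eq_prime_pow (n := 5) h
  have h2 : (2 : F) ≠ 0 := two_ne_zero_of_charP_three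
  refine ⟨isCapThree_setOf_pow_eq (by decide) (fun u => eq_one_of_pow_twentytwo) (pow_ne_zero _ hx),
    fun T hT hST => (hST.antisymm fun t ht => ?_).symm⟩
  by_contra htS
  have hne : ∀ a : F, a ^ 22 = x ^ 22 → a ≠ t := by
    rintro a ha rfl
    exact htS ha
  -- Any further point `t` closes a zero-sum triple with two points of the coset: `x` and `-x` if `t
  -- = 0`, otherwise `a` and `a * u` with `a = -(t / (1 + u))`.
  suffices ∃ a b : F, a ^ 22 = x ^ 22 ∧ b ^ 22 = x ^ 22 ∧ a ≠ b ∧ a + b + t = 0 by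
    obtain ⟨a, b, ha, hb, hab, hs⟩ := this
    exact hT a (hST ha) b (hST hb) t ht hab (hne a ha) (hne b hb) hs
  by_cases ht0 : t = 0
  · refine ⟨x, -x, rfl, Even.neg_pow (by decide) x, ?_, by rw [ht0]; ring⟩
    intro e
    exact hx (mul_left_cancel₀ h2 (by linear_combination e))
  · have hr1 : (t / x) ^ 22 ≠ 1 := by
      rw [div_pow]
      intro e
      exact htS ((div_eq_one_iff_eq (pow_ne_zero _ hx)).1 e)
    have hr : ((t / x) ^ 22) ^ 11 = 1 := by
      rw [← pow_mul]
      have := pow_natCard_sub_one_eq_one (div_ne_zero ht0 hx)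
      rwa [h] at this
    obtain ⟨u, hu, hu1, hur⟩ := exists_pow_twentytwo_of_pow_eleven h hr hr1
    have hu' : 1 + u ≠ 0 := by
      intro e
      rw [e, zero_pow (by norm_num)] at hur
      exact pow_ne_zero 22 (div_ne_zero ht0 hx) hur.symm
    have ha : (-(t / (1 + u))) ^ 22 = x ^ 22 := by
      rw [Even.neg_pow (by decide), div_pow, hur, div_pow]
      have := pow_ne_zero 22 ht0
      field_simp
    refine ⟨-(t / (1 + u)), -(t / (1 + u)) * u, ha, by rw [mul_pow, ha, hu, mul_one], ?_, ?_⟩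
    · intro e
      refine hu1 (mul_left_cancel₀ (neg_ne_zero.2 (div_ne_zero ht0 hu')) ?_)
      rw [← e, mul_one]
    · field_simp
      ring

/-! ### The pairing in order 729. -/

theorem exists_pow_eq_of_pow_eq_one {F : Type*} [Field F] [Finite F] {d k : ℕ} (hk : 0 < k)
    (h : Nat.card F = d * k + 1) {y : F} (hy : y ^ k = 1) : ∃ x : F, x ^ d = y := by
  obtain ⟨g, hg⟩ := IsCyclic.exists_generator (α := Fˣ)
  have ho : orderOf g = d * k := by
    rw [orderOf_eq_card_of_forall_mem_zpowers hg, Nat.card_units, h, Nat.add_sub_cancel]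
  have hy0 : y ≠ 0 := by
    rintro rfl
    rw [zero_pow hk.ne'] at hy
    exact zero_ne_one hy
  obtain ⟨m, hm⟩ := Subgroup.mem_zpowers_iff.1 (hg (Units.mk0 y hy0))
  have h1 : g ^ (m * k) = 1 := by
    rw [zpow_mul, hm, zpow_natCast]
    ext
    simp [hy]
  have hdvd : (d : ℤ) ∣ m := by
    have := orderOf_dvd_iff_zpow_eq_one.2 h1
    rw [ho, Nat.cast_mul] at this
    exact Int.dvd_of_mul_dvd_mul_right (by exact_mod_cast hk.ne') this
  obtain ⟨j, rfl⟩ := hdvd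
  refine ⟨((g ^ j : Fˣ) : F), ?_⟩
  rw [← Units.val_pow_eq_pow_val, ← zpow_natCast, ← zpow_mul, mul_comm, hm, Units.val_mk0]

theorem exists_pairing_of_cosets_twentyeight {F : Type*} [Field F] (h : Nat.card F = 729) :
    ∃ Q : Set (Set F),
      IsPartitionOf Q {x : F | x ≠ 0} ∧
      Q.ncard = 13 ∧
      ∀ P ∈ Q, IsCapThree P ∧ P.ncard = 56 ∧
        ∃ C ∈ multCosets (rootsOfUnity 28 F), ∃ D ∈ multCosets (rootsOfUnity 28 F),
          C ≠ D ∧ P = C ∪ D := by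
  have : Finite F := Nat.finite_of_card_ne_zero (by rw [h]; norm_num)
  have : CharP F 3 := charP_of_natCard_eq_prime_pow (n := 6) h
  have h2 : (2 : F) ≠ 0 := two_ne_zero_of_charP_three
  have h11 : (1 : F) ≠ -1 := fun e => h2 (by linear_combination e)
  obtain ⟨y, hy⟩ := exists_pow_three_eq_sub_one h
  have hy13 := pow_thirteen_of_pow_three hy
  have hy1 : y ≠ 1 := by
    rintro rfl
    exact h11 (by rw [← hy13, one_pow])
  have hy0 : y ≠ 0 := by
    rintro rfl
    simp at hy13
  obtain ⟨x, hx⟩ : ∃ x : F, x ^ 28 = y :=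
    exists_pow_eq_of_pow_eq_one (k := 26) (by norm_num) (by rw [h])
      (by rw [show 26 = 13 * 2 from rfl, pow_mul, hy13, neg_one_sq])
  have hx0 : x ≠ 0 := by
    rintro rfl
    exact hy0 (by rw [← hx, zero_pow (by norm_num)])
  set pair : F → Set F := fun α => {z | z ^ 28 = α ∨ z ^ 28 = α * y} with hpair
  -- The condition selects the square values of `c ^ 28` in the field of order 27. As `y ^ 13 = -1`,
  -- multiplication by `y` exchanges squares and nonsquares, so each nonzero value occurs in exactly
  -- one pair.
  set Q : Set (Set F) := {P | ∃ c : F, (c ^ 28) ^ 13 = 1 ∧ P = pair (c ^ 28)} with hQ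
  have hne : ∀ c : F, (c ^ 28) ^ 13 = 1 → c ≠ 0 := by
    rintro c hc rfl
    simp at hc
  have hunion : ∀ c : F, pair (c ^ 28) = {z | z ^ 28 = c ^ 28} ∪ {z | z ^ 28 = (c * x) ^ 28} := by
    intro c
    ext z
    simp [hpair, mul_pow, hx]
  have hdisj : ∀ c : F, c ≠ 0 → Disjoint {z | z ^ 28 = c ^ 28} {z | z ^ 28 = (c * x) ^ 28} := by
    intro c hc
    refine Set.disjoint_left.2 fun z hz hz' => ?_
    rw [Set.mem_ofPred_eq, mul_pow, hx] at hz'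
    rw [Set.mem_ofPred_eq] at hz
    rw [hz] at hz'
    exact hy1 (mul_left_cancel₀ (pow_ne_zero 28 hc) (by rw [← hz', mul_one]))
  have hcard : ∀ P ∈ Q, P.ncard = 56 := by
    rintro P ⟨c, hc, rfl⟩
    have hc0 := hne c hc
    rw [hunion, Set.ncard_union_eq (hdisj c hc0) (Set.toFinite _) (Set.toFinite _),
      ncard_setOf_pow_eq_pow (k := 26) (by rw [h]) hc0,
      ncard_setOf_pow_eq_pow (k := 26) (by rw [h]) (mul_ne_zero hc0 hx0)]
  have hpart : IsPartitionOf Q {x : F | x ≠ 0} := by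
    refine ⟨?_, ?_, ?_⟩
    · rintro P ⟨c, hc, rfl⟩
      exact ⟨c, Or.inl rfl⟩
    · rintro P ⟨c, hc, rfl⟩ P' ⟨c', hc', rfl⟩ hPP
      refine Set.disjoint_left.2 fun z hz hz' => hPP (congrArg pair ?_)
      rcases hz with hz | hz <;> rcases hz' with hz' | hz'
      · exact hz.symm.trans hz'
      · have := congrArg (· ^ 13) (hz.symm.trans hz')
        simp only [mul_pow _ y, hc, hc', hy13, one_mul] at this
        exact absurd this h11
      · have := congrArg (· ^ 13) (hz'.symm.trans hz)
        simp only [mul_pow _ y, hc, hc', hy13, one_mul] at this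
        exact absurd this h11
      · exact mul_right_cancel₀ hy0 (hz.symm.trans hz')
    · ext z
      simp only [Set.mem_sUnion, Set.mem_ofPred_eq]
      constructor
      · rintro ⟨P, ⟨c, hc, rfl⟩, hz⟩ rfl
        have hc0 := pow_ne_zero 28 (hne c hc)
        rcases hz with hz | hz
        · exact hc0 (by rw [← hz, zero_pow (by norm_num)])
        · exact mul_ne_zero hc0 hy0 (by rw [← hz, zero_pow (by norm_num)])
      · intro hz
        have h1 : (z ^ 28) ^ 13 * (z ^ 28) ^ 13 = 1 := by
          have := pow_natCard_sub_one_eq_one hz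
          rw [h] at this
          rw [← this]
          ring
        rcases mul_self_eq_one_iff.1 h1 with h1 | h1
        · exact ⟨_, ⟨z, h1, rfl⟩, Or.inl rfl⟩
        · refine ⟨_, ⟨z / x, ?_, rfl⟩, Or.inr ?_⟩
          · rw [div_pow, hx, div_pow, h1, hy13, div_self (neg_ne_zero.2 one_ne_zero)]
          · rw [div_pow, hx, div_mul_cancel₀ _ hy0]
  refine ⟨Q, hpart, ?_, ?_⟩
  · have := hpart.ncard_mul hcard
    rw [ncard_setOf_ne_zero, h] at this
    omega
  · intro P hP
    refine ⟨?_, hcard P hP, ?_⟩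
    · obtain ⟨c, hc, rfl⟩ := hP
      exact isCapThree_setOf_pow_twentyeight_eq_or hy (pow_ne_zero 28 (hne c hc))
    · obtain ⟨c, hc, rfl⟩ := hP
      have hc0 := hne c hc
      refine ⟨_, (mem_multCosets_rootsOfUnity (by norm_num)).2 ⟨c, hc0, rfl⟩, _,
        (mem_multCosets_rootsOfUnity (by norm_num)).2 ⟨c * x, mul_ne_zero hc0 hx0, rfl⟩, ?_,
        hunion c⟩
      intro e
      have hc : c ∈ {z | z ^ 28 = (c * x) ^ 28} := by
        rw [← e, Set.mem_ofPred_eq]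
      exact Set.disjoint_left.1 (hdisj c hc0) (show c ∈ {z | z ^ 28 = c ^ 28} from rfl) hc

/-! ### Assembly of the four statements. -/

theorem mainTheorem2 (F : Type*) [Field F] :
    (Nat.card F = 81 →
      IsPartitionOf (multCosets (rootsOfUnity 20 F)) {x : F | x ≠ 0} ∧
      (multCosets (rootsOfUnity 20 F)).ncard = 4 ∧
      ∀ C ∈ multCosets (rootsOfUnity 20 F), IsMaximalCapThree C ∧ C.ncard = 20) ∧
    (Nat.card F = 243 →
      IsPartitionOf (multCosets (rootsOfUnity 22 F)) {x : F | x ≠ 0} ∧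
      (multCosets (rootsOfUnity 22 F)).ncard = 11 ∧
      ∀ C ∈ multCosets (rootsOfUnity 22 F), IsCompleteCapThree C ∧ C.ncard = 22) ∧
    (Nat.card F = 729 →
      (IsPartitionOf (multCosets (rootsOfUnity 28 F)) {x : F | x ≠ 0} ∧
        (multCosets (rootsOfUnity 28 F)).ncard = 26 ∧
        ∀ C ∈ multCosets (rootsOfUnity 28 F), IsCapThree C ∧ C.ncard = 28) ∧
      ∃ Q : Set (Set F),
        IsPartitionOf Q {x : F | x ≠ 0} ∧
        Q.ncard = 13 ∧
        ∀ P ∈ Q, IsCapThree P ∧ P.ncard = 56 ∧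
          ∃ C ∈ multCosets (rootsOfUnity 28 F), ∃ D ∈ multCosets (rootsOfUnity 28 F),
            C ≠ D ∧ P = C ∪ D) ∧
    (∀ n : ℕ, 1 ≤ n → Nat.card F = 2 ^ (2 * n) →
      IsPartitionOf (multCosets (rootsOfUnity (2 ^ n + 1) F)) {x : F | x ≠ 0} ∧
      (multCosets (rootsOfUnity (2 ^ n + 1) F)).ncard = 2 ^ n - 1 ∧
      ∀ C ∈ multCosets (rootsOfUnity (2 ^ n + 1) F), IsCapTwo C ∧ C.ncard = 2 ^ n + 1) := by
  refine ⟨fun h => ?_, fun h => ?_, fun h => ⟨?_, exists_pairing_of_cosets_twentyeight h⟩,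
    fun n _ h => multCosets_partition_isCapTwo h⟩
  · have : Finite F := Nat.finite_of_card_ne_zero (by rw [h]; norm_num)
    have : CharP F 3 := charP_of_natCard_eq_prime_pow (n := 4) h
    obtain ⟨h1, h2, h3⟩ := multCosets_rootsOfUnity_partition (d := 20) (k := 4) (by rw [h])
    refine ⟨h1, h2, fun C hC => ⟨⟨?_, fun T hT => ?_⟩, h3 C hC⟩⟩
    · obtain ⟨x, hx, rfl⟩ := (mem_multCosets_rootsOfUnity (by norm_num)).1 hC
      exact isCapThree_setOf_pow_eq (by decide) (fun u => eq_one_of_pow_twenty) (pow_ne_zero _ hx)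
    · rw [h3 C hC]
      exact hT.ncard_le_twenty h
  · have : Finite F := Nat.finite_of_card_ne_zero (by rw [h]; norm_num)
    obtain ⟨h1, h2, h3⟩ := multCosets_rootsOfUnity_partition (d := 22) (k := 11) (by rw [h])
    refine ⟨h1, h2, fun C hC => ⟨?_, h3 C hC⟩⟩
    obtain ⟨x, hx, rfl⟩ := (mem_multCosets_rootsOfUnity (by norm_num)).1 hC
    exact isCompleteCapThree_setOf_pow_twentytwo h hx
  · have : Finite F := Nat.finite_of_card_ne_zero (by rw [h]; norm_num)
    have : CharP F 3 := charP_of_natCard_eq_prime_pow (n := 6) h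
    obtain ⟨h1, h2, h3⟩ := multCosets_rootsOfUnity_partition (d := 28) (k := 26) (by rw [h])
    refine ⟨h1, h2, fun C hC => ⟨?_, h3 C hC⟩⟩
    obtain ⟨x, hx, rfl⟩ := (mem_multCosets_rootsOfUnity (by norm_num)).1 hC
    exact isCapThree_setOf_pow_eq (by decide) (fun u => eq_one_of_pow_twentyeight)
      (pow_ne_zero _ hx)
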